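/- For $n\ge 2$ let $A_n$ be the alternating group on $\{1,\dots,n\}$, let $U_{A_n}$ be the uniform distribution on $A_n$, and let $P=P_n$ be the probability measure on $A_n$ that gives mass $\frac{1}{2n-3}$ to each of the identity, the $3$-cycles $(i,n-1,n)$ and the $3$-cycles $(i,n,n-1)$, $1\le i\le n-2$ (the transpose top-$2$ with random shuffle). Let $P^{*k}$ be the $k$-fold convolution of $P$ with itself, where $(p*q)(x)=\sum_{y\in A_n}p(xy^{-1})q(y)$ and $P^{*0}$ is the point mass at the identity, and let $\|\mu-\nu\|_{\mathrm{TV}}=\sup_{A\subseteq A_n}|\mu(A)-\nu(A)|$. 1. There are a sequence of real numbers $\delta_n\to 0$ (as $n\to\infty$) and an integer $N$ such that for all $n\ge N$, all real $c<0$ and all integers $k\ge 0$ with $k=(n-\frac32)(\log n+c)$, $$\|P^{*k}-U_{A_n}\|_{\mathrm{TV}}\;\ge\;1-\frac{6}{1+e^{-c}(1+\delta_n)} .$$ 2. For every $\epsilon\in(0,1)$, with $k_n=\lfloor(1-\epsilon)(n-\frac32)\log n\rfloor$, $$\lim_{n\to\infty}\|P^{*k_n}-U_{A_n}\|_{\mathrm{TV}}=1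 .$$ -/

import Mathlib

/-- The convolution `(p * q)(x) = ∑ y, p (x y⁻¹) q y` of two mass functions on a finite group. -/
noncomputable def conv {G : Type*} [Group G] [Fintype G] (p q : G → ℝ) : G → ℝ :=
  fun x => ∑ y : G, p (x * y⁻¹) * q y

/-- The `k`-fold convolution of `p` with itself: the law after `k` steps of the random walk driven
by `p` and started at the identity. The `0`-fold convolution is the point mass at the identity. -/
noncomputable def convPow {G : Type*} [Group G] [Fintype G] [DecidableEq G]
    (p : G → ℝ) : ℕ → G → ℝ
  | 0 => fun x => if x = 1 then 1 else 0
  | k + 1 => conv (convPow p k) p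

/-- The uniform distribution on a finite group. -/
noncomputable def uniformDist (G : Type*) [Fintype G] : G → ℝ :=
  fun _ => 1 / (Fintype.card G : ℝ)

/-- The total variation distance `sup_A |μ(A) - ν(A)|` of two mass functions on a finite set. -/
noncomputable def tvDist {Ω : Type*} [Fintype Ω] (μ ν : Ω → ℝ) : ℝ :=
  ⨆ A : Finset Ω, |∑ x ∈ A, μ x - ∑ x ∈ A, ν x|

/-- The increments of the transpose top-2 with random shuffle, for the cards `0, …, n - 1`:
the identity and the 3-cycles `(i, a, b)` and `(i, b, a)`, where `a = n - 2` and `b = n - 1` are the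
last two cards and `i < n - 2`. (`List.formPerm [x, y, z]` is the cycle `x ↦ y ↦ z ↦ x`.) -/
def topTwoIncrements (n : ℕ) : Set (alternatingGroup (Fin n)) :=
  {π | π = 1 ∨ ∃ i a b : Fin n, i.val < n - 2 ∧ a.val = n - 2 ∧ b.val = n - 1 ∧
    ((π : Equiv.Perm (Fin n)) = List.formPerm [i, a, b] ∨
      (π : Equiv.Perm (Fin n)) = List.formPerm [i, b, a])}

/-- The law of one step of the transpose top-2 with random shuffle on `A_n`: mass `1 / (2n - 3)` on
each of the `2n - 3` increments (a probability for `n ≥ 2`). -/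
noncomputable def topTwoShuffle (n : ℕ) : alternatingGroup (Fin n) → ℝ :=
  (topTwoIncrements n).indicator (fun _ => 1 / (2 * (n : ℝ) - 3))

/-- The total variation distance between the law of the shuffle after `k` steps and the uniform
distribution on `A_n`. -/
noncomputable def shuffleTV (n k : ℕ) : ℝ :=
  tvDist (convPow (topTwoShuffle n) k) (uniformDist (alternatingGroup (Fin n)))

/-! ### Random words and convolution powers. -/

section Convolution

/-! Fixed points separate the two laws. Put `n = m + 2`. One increment touches a given card `i < m`
with probability `2 / (2m + 1) = 1 / (n - 3/2)`, so after `k` steps the expected number of untouched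
cards is `μ = m q ^ k`, with `q = 1 - 1 / (n - 3/2)`. Touching two different cards are disjoint
events, which makes the survival events negatively correlated and bounds the variance by `μ`.
Untouched cards are fixed points, so under the walk there are rarely fewer than `μ / 2` of them
(`sum_convPow_filter_lt_le`). Under the uniform law the number of fixed points has mean `1` and
second moment at most `2`, so it rarely reaches `μ / 2`. The two error bounds, `4 / (1 + μ)` and `2
/ (1 + μ)`, give `one_sub_le_shuffleTV`.

For `k = (n - 3/2)(log n + c)`, `μ` is at least `e^{-c} (1 + δ n)` by `exp_mul_le_one_sub_pow`. The
limit follows since `-c ≥ ε log n` there. -/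

theorem sum_prod_mul_prod {H : Type*} [Fintype H] (p e : H → ℝ) (k : ℕ) :
    ∑ w : Fin k → H, (∏ j, p (w j)) * ∏ j, e (w j) = (∑ y, p y * e y) ^ k := by
  have h := Finset.prod_univ_sum (fun _ : Fin k => (Finset.univ : Finset H))
    (fun _ y => p y * e y)
  rw [Finset.prod_const, Finset.card_univ, Fintype.card_fin, Fintype.piFinset_univ] at h
  rw [h]
  simp only [Finset.prod_mul_distrib]

theorem sum_prod_eq_one {H : Type*} [Fintype H] {p : H → ℝ} (hp : ∑ y, p y = 1) (k : ℕ) :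
    ∑ w : Fin k → H, ∏ j, p (w j) = 1 := by
  simpa [hp] using sum_prod_mul_prod p (fun _ => 1) k

variable {G : Type*} [Group G] [Fintype G] [DecidableEq G]

/-- Expectations under the walk become expectations over words of `k` independent increments, where
untouched cards can be counted. Each new increment multiplies on the right, hence the `snoc`
decomposition. -/
theorem sum_convPow_mul (p : G → ℝ) (k : ℕ) (F : G → ℝ) :
    ∑ x, convPow p k x * F x =
      ∑ w : Fin k → G, (∏ j, p (w j)) * F (List.ofFn w).prod := by
  induction k generalizing F with
  | zero => simp [convPow]
  | succ k ih =>
    have key : ∑ x, convPow p (k + 1) x * F x =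
        ∑ y, p y * ∑ z, convPow p k z * F (z * y) := by
      simp only [convPow, conv, Finset.sum_mul, Finset.mul_sum]
      rw [Finset.sum_comm]
      refine Finset.sum_congr rfl fun y _ => ?_
      refine Fintype.sum_equiv (Equiv.mulRight y⁻¹) _ _ fun x => ?_
      simp
      ring
    rw [key, ← (Fin.snocEquiv fun _ : Fin (k + 1) => G).sum_comp, Fintype.sum_prod_type]
    refine Finset.sum_congr rfl fun y _ => ?_
    rw [ih fun z => F (z * y), Finset.mul_sum]
    refine Finset.sum_congr rfl fun w _ => ?_
    simp only [Fin.snocEquiv, Equiv.coe_fn_mk, Fin.prod_univ_castSucc, Fin.snoc_castSucc,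
      Fin.snoc_last, List.ofFn_succ', List.concat_eq_append, List.prod_append, List.prod_singleton]
    ring

theorem sum_convPow {p : G → ℝ} (hp : ∑ y, p y = 1) (k : ℕ) : ∑ x, convPow p k x = 1 := by
  simpa [sum_prod_eq_one hp] using sum_convPow_mul p k fun _ => 1

theorem convPow_nonneg {p : G → ℝ} (hp : ∀ y, 0 ≤ p y) (k : ℕ) (x : G) : 0 ≤ convPow p k x := by
  induction k generalizing x with
  | zero => simp only [convPow]; split_ifs <;> norm_num
  | succ k ih => exact Finset.sum_nonneg fun y _ => mul_nonneg (ih _) (hp y)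

end Convolution

/-! ### Total variation and a second-moment tail bound. -/

section TotalVariation

variable {Ω : Type*} [Fintype Ω]

theorem abs_sum_sub_sum_le_tvDist (μ ν : Ω → ℝ) (A : Finset Ω) :
    |∑ x ∈ A, μ x - ∑ x ∈ A, ν x| ≤ tvDist μ ν :=
  le_ciSup (f := fun A : Finset Ω => |∑ x ∈ A, μ x - ∑ x ∈ A, ν x|)
    (Set.finite_range _).bddAbove A

theorem tvDist_nonneg (μ ν : Ω → ℝ) : 0 ≤ tvDist μ ν := by
  simpa using abs_sum_sub_sum_le_tvDist μ ν ∅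

theorem tvDist_le_one {μ ν : Ω → ℝ} (hμ : ∀ x, 0 ≤ μ x) (hν : ∀ x, 0 ≤ ν x)
    (hμ1 : ∑ x, μ x = 1) (hν1 : ∑ x, ν x = 1) : tvDist μ ν ≤ 1 := by
  refine ciSup_le fun A => abs_sub_le_iff.2 ?_
  have h (ρ : Ω → ℝ) (hρ : ∀ x, 0 ≤ ρ x) (hρ1 : ∑ x, ρ x = 1) :
      0 ≤ ∑ x ∈ A, ρ x ∧ ∑ x ∈ A, ρ x ≤ 1 :=
    ⟨Finset.sum_nonneg fun x _ => hρ x,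
      hρ1 ▸ Finset.sum_le_univ_sum_of_nonneg hρ⟩
  have := h μ hμ hμ1
  have := h ν hν hν1
  constructor <;> linarith

/-- Markov's inequality for the square of `a + b * X`. -/
theorem sum_filter_le_of_sq_moment {W X : Ω → ℝ} (hW : ∀ x, 0 ≤ W x) {a b d : ℝ} (hd : 0 < d)
    (P : Ω → Prop) [DecidablePred P] (hP : ∀ x, P x → d ≤ a + b * X x) :
    ∑ x with P x, W x ≤
      (a ^ 2 * ∑ x, W x + 2 * a * b * ∑ x, W x * X x + b ^ 2 * ∑ x, W x * X x ^ 2) / d ^ 2 := by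
  rw [le_div_iff₀ (by positivity)]
  have h : a ^ 2 * ∑ x, W x + 2 * a * b * ∑ x, W x * X x + b ^ 2 * ∑ x, W x * X x ^ 2 =
      ∑ x, W x * (a + b * X x) ^ 2 := by
    simp only [Finset.mul_sum, ← Finset.sum_add_distrib]
    exact Finset.sum_congr rfl fun x _ => by ring
  rw [h, Finset.sum_mul]
  calc ∑ x with P x, W x * d ^ 2 ≤ ∑ x with P x, W x * (a + b * X x) ^ 2 :=
        Finset.sum_le_sum fun x hx =>
          mul_le_mul_of_nonneg_left
            (pow_le_pow_left₀ hd.le (hP x (Finset.mem_filter.1 hx).2) 2) (hW x)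
    _ ≤ _ := Finset.sum_le_univ_sum_of_nonneg fun x => mul_nonneg (hW x) (sq_nonneg _)

end TotalVariation

/-! ### Concentration of the number of untouched points. -/

section Untouched

variable {G : Type*} [Group G] [Fintype G] [DecidableEq G]

/-- Here `e i` indicates that an increment leaves `i` alone, and `U` counts the indices left alone
by a whole word. Independence turns its first two moments into sums of `k`-th powers; `hqq` carries
an absolute value so that it survives taking them. -/
theorem sum_convPow_filter_lt_le {ι : Type*} [Fintype ι] {p : G → ℝ} (hp : ∀ y, 0 ≤ p y)
    (hp1 : ∑ y, p y = 1) (e : ι → G → ℝ) (he : ∀ i y, e i y = 0 ∨ e i y = 1) {q : ℝ}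
    (hq : ∀ i, ∑ y, p y * e i y = q)
    (hqq : ∀ i j, i ≠ j → |∑ y, p y * (e i y * e j y)| ≤ q ^ 2)
    (k : ℕ) (f : G → ℝ)
    (hf : ∀ w : Fin k → G, ∑ i, ∏ j, e i (w j) ≤ f (List.ofFn w).prod)
    {μ : ℝ} (hμ : μ = Fintype.card ι * q ^ k) (hμ0 : 0 ≤ μ) :
    ∑ x with f x < μ / 2, convPow p k x ≤ 4 / (μ + 4) := by
  have hW : ∀ w : Fin k → G, 0 ≤ ∏ j, p (w j) := fun w => Finset.prod_nonneg fun j _ => hp _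
  set U : (Fin k → G) → ℝ := fun w => ∑ i, ∏ j, e i (w j) with hU
  have h1 : ∑ w : Fin k → G, (∏ j, p (w j)) * U w = μ := by
    simp only [hU, Finset.mul_sum]
    rw [Finset.sum_comm]
    simp [sum_prod_mul_prod, hq, hμ]
  have h2 : ∑ w : Fin k → G, (∏ j, p (w j)) * U w ^ 2 ≤ μ + μ ^ 2 := by
    have hsq : ∀ w, (∏ j, p (w j)) * U w ^ 2 =
        ∑ i, ∑ i', (∏ j, p (w j)) * ∏ j, (e i (w j) * e i' (w j)) := fun w => by
      simp only [hU, sq, Finset.prod_mul_distrib]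
      rw [Finset.sum_mul_sum]
      simp only [Finset.mul_sum]
    simp only [hsq]
    rw [Finset.sum_comm]
    have hle : ∀ i, ∑ w : Fin k → G, ∑ i', (∏ j, p (w j)) * ∏ j, (e i (w j) * e i' (w j)) ≤
        q ^ k + Fintype.card ι * (q ^ k) ^ 2 := fun i => by
      classical
      rw [Finset.sum_comm]
      calc ∑ i', ∑ w : Fin k → G, (∏ j, p (w j)) * ∏ j, (e i (w j) * e i' (w j))
          = ∑ i', (∑ y, p y * (e i y * e i' y)) ^ k :=
            Finset.sum_congr rfl fun i' _ => sum_prod_mul_prod p (fun y => e i y * e i' y) k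
        _ ≤ ∑ i', ((if i = i' then q ^ k else 0) + (q ^ k) ^ 2) := by
            refine Finset.sum_le_sum fun i' _ => ?_
            split_ifs with h
            · subst h
              have : ∀ y, e i y * e i y = e i y := fun y => by
                rcases he i y with h | h <;> simp [h]
              simp only [this, hq]
              nlinarith [sq_nonneg (q ^ k)]
            · rw [zero_add, ← pow_mul, mul_comm k 2, pow_mul]
              calc _ ≤ |∑ y, p y * (e i y * e i' y)| ^ k := by
                    rw [← abs_pow]; exact le_abs_self _
                _ ≤ _ := pow_le_pow_left₀ (abs_nonneg _) (hqq i i' h) k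
        _ = _ := by simp [Finset.sum_add_distrib]
    calc _ ≤ ∑ _i : ι, (q ^ k + Fintype.card ι * (q ^ k) ^ 2) :=
          Finset.sum_le_sum fun i _ => hle i
      _ = μ + μ ^ 2 := by simp [hμ]; ring
  have h3 : ∑ x with f x < μ / 2, convPow p k x ≤
      ∑ w : Fin k → G with U w < μ / 2, ∏ j, p (w j) := by
    have := sum_convPow_mul p k fun x => if f x < μ / 2 then 1 else 0
    simp only [mul_ite, mul_one, mul_zero, ← Finset.sum_filter] at this
    rw [this]
    refine Finset.sum_le_sum_of_subset_of_nonneg ?_ fun w _ _ => hW w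
    intro w hw
    simp only [Finset.mem_filter, Finset.mem_univ, true_and] at hw ⊢
    exact (hf w).trans_lt hw
  -- One-sided Chebyshev: with variance at most `μ` and deviation `μ / 2`, the optimal shift is `μ /
  -- (μ / 2) = 2`.
  have h4 := sum_filter_le_of_sq_moment (W := fun w : Fin k → G => ∏ j, p (w j)) (X := U) hW
    (a := μ + 2) (b := -1) (d := μ / 2 + 2) (by positivity) (fun w => U w < μ / 2)
    (fun w hw => by linarith)
  rw [sum_prod_eq_one hp1, h1] at h4
  refine h3.trans (h4.trans ?_)
  rw [div_le_div_iff₀ (by positivity) (by positivity)]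
  nlinarith

end Untouched

/-! ### Moments of the number of fixed points under the uniform law. -/

section AlternatingFixedPoints

variable {α : Type*} [Fintype α] [DecidableEq α]

/-- The number of fixed points of an even permutation, as a real number. -/
noncomputable def fixedPointCount (π : alternatingGroup α) : ℝ :=
  ∑ i, if (π : Equiv.Perm α) i = i then 1 else 0

theorem alternatingGroup_exists_smul_pair (h : 4 ≤ Fintype.card α) {a b c d : α} (hab : a ≠ b)
    (hcd : c ≠ d) : ∃ π : alternatingGroup α, π • a = c ∧ π • b = d := by
  have h1 := alternatingGroup.isMultiplyPretransitive α
  have h2 : MulAction.IsMultiplyPretransitive (alternatingGroup α) α 2 :=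
    MulAction.isMultiplyPretransitive_of_le (n := Nat.card α - 2)
      (by rw [Nat.card_eq_fintype_card]; omega) (Nat.sub_le _ _)
  exact MulAction.is_two_pretransitive_iff.1 h2 hab hcd

/-- Burnside's lemma for a transitive action. -/
theorem sum_fixedPointCount (h : 4 ≤ Fintype.card α) :
    ∑ π : alternatingGroup α, fixedPointCount π = Fintype.card (alternatingGroup α) := by
  classical
  have hb := MulAction.sum_card_fixedBy_eq_card_orbits_mul_card_group (alternatingGroup α) α
  have ho : Fintype.card (Quotient (MulAction.orbitRel (alternatingGroup α) α)) = 1 := by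
    obtain ⟨x⟩ : Nonempty α := Fintype.card_pos_iff.1 (by omega)
    refine Fintype.card_eq_one_iff.2 ⟨Quotient.mk'' x, fun y => ?_⟩
    induction y using Quotient.inductionOn' with | _ y
    refine Quotient.sound' ?_
    rw [MulAction.orbitRel_apply]
    by_cases hxy : x = y
    · rw [hxy]; exact MulAction.mem_orbit_self _
    · obtain ⟨π, hπ, -⟩ := alternatingGroup_exists_smul_pair h hxy (Ne.symm hxy)
      exact ⟨π, hπ⟩
  rw [ho, one_mul] at hb
  rw [← hb]
  push_cast
  refine Finset.sum_congr rfl fun π _ => ?_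
  rw [Fintype.card_subtype, fixedPointCount, Finset.sum_boole]
  rfl

/-- The square counts fixed points on ordered pairs. By 2-transitivity the diagonal and its
complement are the only orbits, so Burnside gives the factor `2`. -/
theorem sum_fixedPointCount_sq_le (h : 4 ≤ Fintype.card α) :
    ∑ π : alternatingGroup α, fixedPointCount π ^ 2 ≤
      2 * Fintype.card (alternatingGroup α) := by
  classical
  have hb := MulAction.sum_card_fixedBy_eq_card_orbits_mul_card_group (alternatingGroup α) (α × α)
  have ho : Fintype.card (Quotient (MulAction.orbitRel (alternatingGroup α) (α × α))) ≤ 2 := by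
    let g : Quotient (MulAction.orbitRel (alternatingGroup α) (α × α)) → Prop :=
      Quotient.lift (fun x : α × α => x.1 = x.2) (by
        rintro x y ⟨π, rfl⟩
        simp)
    have hg : Function.Injective g := by
      intro x y hxy
      induction x using Quotient.inductionOn' with | _ x
      induction y using Quotient.inductionOn' with | _ y
      replace hxy : (x.1 = x.2) = (y.1 = y.2) := hxy
      obtain ⟨a, b⟩ := x
      obtain ⟨c, d⟩ := y
      refine Quotient.sound' ?_
      rw [MulAction.orbitRel_apply]
      simp only [eq_iff_iff] at hxy
      by_cases hcd : c = d
      · obtain rfl := hxy.2 hcd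
        subst hcd
        by_cases hac : c = a
        · rw [hac]; exact MulAction.mem_orbit_self _
        · obtain ⟨π, hπ, -⟩ := alternatingGroup_exists_smul_pair h hac (Ne.symm hac)
          exact ⟨π, by simp [hπ]⟩
      · obtain ⟨π, h1, h2⟩ := alternatingGroup_exists_smul_pair h hcd (mt hxy.1 hcd)
        exact ⟨π, by simp [h1, h2]⟩
    simpa using Fintype.card_le_of_injective g hg
  have hs : ∑ π : alternatingGroup α, fixedPointCount π ^ 2 =
      ((∑ π : alternatingGroup α, Fintype.card (MulAction.fixedBy (α × α) π) : ℕ) : ℝ) := by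
    push_cast
    refine Finset.sum_congr rfl fun π _ => ?_
    rw [Fintype.card_subtype, ← Finset.sum_boole, Fintype.sum_prod_type, fixedPointCount, sq,
      Finset.sum_mul_sum]
    refine Finset.sum_congr rfl fun i _ => Finset.sum_congr rfl fun j _ => ?_
    have : (i, j) ∈ MulAction.fixedBy (α × α) π ↔
        (π : Equiv.Perm α) i = i ∧ (π : Equiv.Perm α) j = j := by
      rw [MulAction.mem_fixedBy, Prod.smul_mk, Prod.mk.injEq]
      rfl
    simp only [this, ite_and]
    split_ifs <;> simp
  rw [hs, hb]
  push_cast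
  gcongr
  exact_mod_cast ho

theorem sum_uniformDist (Ω : Type*) [Fintype Ω] [Nonempty Ω] : ∑ x, uniformDist Ω x = 1 := by
  simp [uniformDist]

theorem uniformDist_nonneg (Ω : Type*) [Fintype Ω] (x : Ω) : 0 ≤ uniformDist Ω x := by
  unfold uniformDist; positivity

end AlternatingFixedPoints

/-! ### The shuffle: its increments and the bound in terms of `μ`. -/

section TopTwo

variable {m : ℕ}

/-- The increments of the shuffle of `m + 2` cards, as permutations: the identity, and for each
card `i < m` the two `3`-cycles through `i` and the last two cards. -/
def topTwoPerm : Option (Fin m × Bool) → Equiv.Perm (Fin (m + 2))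
  | none => 1
  | some (i, true) =>
      List.formPerm [i.castSucc.castSucc, (Fin.last m).castSucc, Fin.last (m + 1)]
  | some (i, false) =>
      List.formPerm [i.castSucc.castSucc, Fin.last (m + 1), (Fin.last m).castSucc]

theorem topTwoPerm_mem_alternatingGroup (x : Option (Fin m × Bool)) :
    topTwoPerm x ∈ alternatingGroup (Fin (m + 2)) := by
  have h1 : ∀ i : Fin m, i.castSucc.castSucc ≠ (Fin.last m).castSucc := fun i => by
    simp [Fin.ext_iff, i.2.ne]
  have h2 : ∀ i : Fin m, i.castSucc.castSucc ≠ Fin.last (m + 1) := fun i => by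
    simp only [ne_eq, Fin.ext_iff, Fin.val_castSucc, Fin.val_last]; omega
  have h3 : (Fin.last m).castSucc ≠ Fin.last (m + 1) := by simp [Fin.ext_iff]
  rw [Equiv.Perm.mem_alternatingGroup]
  rcases x with _ | ⟨i, _ | _⟩ <;>
    simp [topTwoPerm, h1, h2, h3, h3.symm]

theorem topTwoPerm_castSucc_eq_self_iff (x : Option (Fin m × Bool)) (j : Fin m) :
    topTwoPerm x j.castSucc.castSucc = j.castSucc.castSucc ↔ ∀ b, x ≠ some (j, b) := by
  have hj := j.2
  rcases x with _ | ⟨i, _ | _⟩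
  · simp [topTwoPerm]
  all_goals
    have hi := i.2
    simp only [topTwoPerm, List.formPerm_cons_cons, List.formPerm_singleton, mul_one,
      Equiv.Perm.mul_apply, Equiv.swap_apply_def, Fin.ext_iff, Fin.val_castSucc, Fin.val_last,
      ne_eq, Option.some.injEq, Prod.mk.injEq, not_and, Bool.forall_bool]
    split_ifs <;> simp_all <;> omega

/-- The image of card `i` tells the two cycles through `i` apart from each other and from every
increment that fixes `i`. -/
theorem topTwoPerm_injective : Function.Injective (topTwoPerm (m := m)) := by
  intro x y h
  by_contra hxy
  have key (z : Option (Fin m × Bool)) (i : Fin m) :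
      topTwoPerm z i.castSucc.castSucc = i.castSucc.castSucc ∨
        (z = some (i, true) ∧ topTwoPerm z i.castSucc.castSucc = (Fin.last m).castSucc) ∨
        (z = some (i, false) ∧ topTwoPerm z i.castSucc.castSucc = Fin.last (m + 1)) := by
    by_cases hz : ∀ b, z ≠ some (i, b)
    · exact Or.inl ((topTwoPerm_castSucc_eq_self_iff z i).2 hz)
    · push Not at hz
      obtain ⟨b, rfl⟩ := hz
      have hi := i.2
      right
      rcases b with _ | _
      · right
        refine ⟨rfl, ?_⟩
        rw [topTwoPerm, List.formPerm_apply_head]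
        simp [Fin.ext_iff]; omega
      · left
        refine ⟨rfl, ?_⟩
        rw [topTwoPerm, List.formPerm_apply_head]
        simp [Fin.ext_iff]; omega
  have hne (z z' : Option (Fin m × Bool)) (i : Fin m) (b : Bool) (hz : z = some (i, b))
      (hzz : topTwoPerm z = topTwoPerm z') : z = z' := by
    have hi := i.2
    have hmv : topTwoPerm z i.castSucc.castSucc ≠ i.castSucc.castSucc := fun hc =>
      (topTwoPerm_castSucc_eq_self_iff z i).1 hc b hz
    rcases key z i with h1 | ⟨h1, h1'⟩ | ⟨h1, h1'⟩ <;>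
      rcases key z' i with h2 | ⟨h2, h2'⟩ | ⟨h2, h2'⟩ <;>
      first
      | exact absurd h1 hmv
      | exact absurd h2 (hzz ▸ hmv)
      | exact h1.trans h2.symm
      | (rw [hzz, h2'] at h1'; simp [Fin.ext_iff] at h1')
  rcases x with _ | ⟨i, b⟩
  · rcases y with _ | ⟨i, b⟩
    · exact hxy rfl
    · exact hxy (hne _ _ i b rfl h.symm).symm
  · exact hxy (hne _ _ i b rfl h)

/-- `topTwoPerm` with values in the alternating group. -/
def topTwoIncrement (x : Option (Fin m × Bool)) : alternatingGroup (Fin (m + 2)) :=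
  ⟨topTwoPerm x, topTwoPerm_mem_alternatingGroup x⟩

theorem topTwoIncrement_injective : Function.Injective (topTwoIncrement (m := m)) :=
  fun _ _ h => topTwoPerm_injective (congrArg Subtype.val h)

theorem range_topTwoIncrement : Set.range (topTwoIncrement (m := m)) = topTwoIncrements (m + 2) := by
  ext π
  simp only [topTwoIncrements, Set.mem_range, Set.mem_ofPred_eq, Nat.add_sub_cancel]
  constructor
  · rintro ⟨_ | ⟨i, _ | _⟩, rfl⟩
    · left; rfl
    · exact Or.inr ⟨i.castSucc.castSucc, (Fin.last m).castSucc, Fin.last (m + 1), i.2, rfl, rfl,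
        Or.inr rfl⟩
    · exact Or.inr ⟨i.castSucc.castSucc, (Fin.last m).castSucc, Fin.last (m + 1), i.2, rfl, rfl,
        Or.inl rfl⟩
  · rintro (rfl | ⟨i, a, b, hi, ha, hb, h⟩)
    · exact ⟨none, rfl⟩
    · obtain rfl : a = (Fin.last m).castSucc := Fin.ext ha
      obtain rfl : b = Fin.last (m + 1) := Fin.ext hb
      rcases h with h | h
      · exact ⟨some (⟨i, hi⟩, true), Subtype.ext h.symm⟩
      · exact ⟨some (⟨i, hi⟩, false), Subtype.ext h.symm⟩

theorem sum_topTwoShuffle_mul (F : alternatingGroup (Fin (m + 2)) → ℝ) :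
    ∑ π, topTwoShuffle (m + 2) π * F π =
      (∑ x : Option (Fin m × Bool), F (topTwoIncrement x)) / (2 * m + 1) := by
  classical
  have h1 : ∀ π, topTwoShuffle (m + 2) π * F π =
      if π ∈ Finset.univ.image (topTwoIncrement (m := m)) then F π / (2 * m + 1) else 0 := by
    intro π
    have : π ∈ Finset.univ.image (topTwoIncrement (m := m)) ↔ π ∈ topTwoIncrements (m + 2) := by
      rw [← range_topTwoIncrement]; simp
    simp only [topTwoShuffle, Set.indicator_apply, this]
    split_ifs
    · push_cast; rw [show (2 * ((m : ℝ) + 2) - 3) = 2 * m + 1 by ring]; ring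
    · simp
  simp only [h1]
  rw [Finset.sum_ite_mem, Finset.univ_inter,
    Finset.sum_image fun _ _ _ _ h => topTwoIncrement_injective h, Finset.sum_div]

theorem topTwoShuffle_nonneg (π : alternatingGroup (Fin (m + 2))) :
    0 ≤ topTwoShuffle (m + 2) π := by
  refine Set.indicator_nonneg (fun _ _ => ?_) π
  push_cast
  rw [show (2 * ((m : ℝ) + 2) - 3) = 2 * m + 1 by ring]
  positivity

theorem sum_topTwoShuffle : ∑ π, topTwoShuffle (m + 2) π = 1 := by
  have := sum_topTwoShuffle_mul (m := m) fun _ => 1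
  simp only [mul_one] at this
  rw [this]
  simp [Fintype.card_option]
  field_simp

/-- The indicator of the even permutations that fix the card `i < m`. -/
noncomputable def fixIndicator (i : Fin m) (π : alternatingGroup (Fin (m + 2))) : ℝ :=
  if (π : Equiv.Perm (Fin (m + 2))) i.castSucc.castSucc = i.castSucc.castSucc then 1 else 0

theorem fixIndicator_topTwoIncrement_some (i j : Fin m) (b : Bool) :
    fixIndicator i (topTwoIncrement (some (j, b))) = 1 - if j = i then 1 else 0 := by
  have : (topTwoIncrement (some (j, b)) : Equiv.Perm (Fin (m + 2))) i.castSucc.castSucc =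
      i.castSucc.castSucc ↔ ¬ j = i := by
    refine (topTwoPerm_castSucc_eq_self_iff _ _).trans ?_
    simp
  simp only [fixIndicator, this]
  split_ifs <;> simp

theorem fixIndicator_topTwoIncrement_none (i : Fin m) :
    fixIndicator i (topTwoIncrement none) = 1 := by
  simp [fixIndicator, topTwoIncrement, topTwoPerm]

theorem sum_topTwoShuffle_mul_fixIndicator (i : Fin m) :
    ∑ π, topTwoShuffle (m + 2) π * fixIndicator i π = 1 - 2 / (2 * m + 1) := by
  rw [sum_topTwoShuffle_mul, Fintype.sum_option, Fintype.sum_prod_type]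
  simp only [fixIndicator_topTwoIncrement_some, fixIndicator_topTwoIncrement_none]
  simp [Finset.sum_sub_distrib]
  field_simp
  ring

theorem sum_topTwoShuffle_mul_fixIndicator_mul (i j : Fin m) (hij : i ≠ j) :
    ∑ π, topTwoShuffle (m + 2) π * (fixIndicator i π * fixIndicator j π) =
      1 - 4 / (2 * m + 1) := by
  rw [sum_topTwoShuffle_mul, Fintype.sum_option, Fintype.sum_prod_type]
  have h : ∀ x : Fin m, ((1 : ℝ) - if x = i then 1 else 0) * (1 - if x = j then 1 else 0) =
      1 - (if x = i then 1 else 0) - if x = j then 1 else 0 := fun x => by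
    by_cases h1 : x = i
    · simp [h1, hij]
    · simp [h1]
  simp only [fixIndicator_topTwoIncrement_some, fixIndicator_topTwoIncrement_none, h]
  simp [Finset.sum_sub_distrib]
  field_simp
  ring

theorem sum_prod_fixIndicator_le_fixedPointCount {k : ℕ}
    (w : Fin k → alternatingGroup (Fin (m + 2))) :
    ∑ i, ∏ j, fixIndicator i (w j) ≤ fixedPointCount (List.ofFn w).prod := by
  have h1 : ∀ i : Fin m, ∏ j, fixIndicator i (w j) ≤
      if ((List.ofFn w).prod : Equiv.Perm (Fin (m + 2))) i.castSucc.castSucc =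
        i.castSucc.castSucc then 1 else 0 := fun i => by
    by_cases h : ∀ j, (w j : Equiv.Perm (Fin (m + 2))) i.castSucc.castSucc = i.castSucc.castSucc
    · have hs : (List.ofFn w).prod ∈ MulAction.stabilizer (alternatingGroup (Fin (m + 2)))
          (i.castSucc.castSucc : Fin (m + 2)) := by
        refine Subgroup.list_prod_mem _ fun x hx => ?_
        obtain ⟨j, rfl⟩ := (List.mem_ofFn' _ _).1 hx
        exact h j
      have hs' : ((List.ofFn w).prod : Equiv.Perm (Fin (m + 2))) i.castSucc.castSucc =
        i.castSucc.castSucc := hs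
      rw [if_pos hs']
      simp [fixIndicator, h]
    · push Not at h
      obtain ⟨j, hj⟩ := h
      rw [Finset.prod_eq_zero (Finset.mem_univ j) (by simp [fixIndicator, hj])]
      split_ifs <;> simp
  rw [fixedPointCount, Fin.sum_univ_castSucc, Fin.sum_univ_castSucc]
  refine (Finset.sum_le_sum fun i _ => h1 i).trans ?_
  have : ∀ (P : Prop) [Decidable P], (0 : ℝ) ≤ if P then 1 else 0 := fun P _ => by
    split_ifs <;> simp
  linarith [this (((List.ofFn w).prod : Equiv.Perm (Fin (m + 2))) (Fin.last m).castSucc =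
    (Fin.last m).castSucc), this (((List.ofFn w).prod : Equiv.Perm (Fin (m + 2)))
    (Fin.last (m + 1)) = Fin.last (m + 1))]

theorem shuffleTV_nonneg (n k : ℕ) : 0 ≤ shuffleTV n k := tvDist_nonneg _ _

theorem shuffleTV_le_one (m k : ℕ) : shuffleTV (m + 2) k ≤ 1 :=
  tvDist_le_one (convPow_nonneg topTwoShuffle_nonneg k) (uniformDist_nonneg _)
    (sum_convPow sum_topTwoShuffle k) (sum_uniformDist _)

theorem one_sub_le_shuffleTV (hm : 2 ≤ m) (k : ℕ) :
    1 - 6 / (1 + m * (1 - 2 / (2 * (m : ℝ) + 1)) ^ k) ≤ shuffleTV (m + 2) k := by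
  have hm' : (2 : ℝ) ≤ m := by exact_mod_cast hm
  have hq0 : (0 : ℝ) ≤ 1 - 2 / (2 * m + 1) := by
    rw [sub_nonneg, div_le_one (by positivity)]; linarith
  set q : ℝ := 1 - 2 / (2 * m + 1) with hq
  set μ : ℝ := m * q ^ k with hμ
  have hμ0 : 0 ≤ μ := by positivity
  -- For `μ < 5` the claimed lower bound is at most `0`.
  rcases lt_or_ge μ 5 with h5 | h5
  · refine le_trans ?_ (shuffleTV_nonneg _ _)
    rw [sub_nonpos, one_le_div (by positivity)]
    linarith
  have hcard : 4 ≤ Fintype.card (Fin (m + 2)) := by simpa using hm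
  have hA := sum_convPow_filter_lt_le (p := topTwoShuffle (m + 2)) topTwoShuffle_nonneg
    sum_topTwoShuffle (fixIndicator (m := m))
    (fun i π => by unfold fixIndicator; split_ifs <;> simp) (q := q)
    sum_topTwoShuffle_mul_fixIndicator
    -- The joint probability is `2q - 1 = q² - (1 - q)²`.
    (fun i j hij => by
      rw [sum_topTwoShuffle_mul_fixIndicator_mul i j hij, abs_of_nonneg]
      · rw [hq]
        have : (0 : ℝ) ≤ (2 / (2 * m + 1)) ^ 2 := by positivity
        have h4 : (4 : ℝ) / (2 * m + 1) = 2 * (2 / (2 * m + 1)) := by ring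
        rw [h4]
        nlinarith
      · rw [sub_nonneg, div_le_one (by positivity)]; linarith)
    k fixedPointCount sum_prod_fixIndicator_le_fixedPointCount (μ := μ) (by simp [hμ]) hμ0
  -- The shift `-1/3` is the optimal one-sided Chebyshev shift at the boundary `μ = 5`, for mean and
  -- variance `1`.
  have hB := sum_filter_le_of_sq_moment (W := uniformDist (alternatingGroup (Fin (m + 2))))
    (X := fixedPointCount) (uniformDist_nonneg _) (a := -1 / 3) (b := 1) (d := μ / 2 - 1 / 3)
    (by linarith) (fun π => ¬ fixedPointCount π < μ / 2) (fun π hπ => by linarith)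
  have hc : (0 : ℝ) < Fintype.card (alternatingGroup (Fin (m + 2))) := by
    exact_mod_cast Fintype.card_pos
  have hu1 : ∑ π, uniformDist (alternatingGroup (Fin (m + 2))) π * fixedPointCount π = 1 := by
    simp only [uniformDist, ← Finset.mul_sum, sum_fixedPointCount hcard]
    field_simp
  have hu2 : ∑ π, uniformDist (alternatingGroup (Fin (m + 2))) π * fixedPointCount π ^ 2 ≤ 2 := by
    simp only [uniformDist, ← Finset.mul_sum]
    rw [div_mul_eq_mul_div, one_mul, div_le_iff₀ hc]
    exact sum_fixedPointCount_sq_le hcard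
  rw [sum_uniformDist, hu1] at hB
  have hB' : ∑ π with ¬ fixedPointCount π < μ / 2,
      uniformDist (alternatingGroup (Fin (m + 2))) π ≤ 2 / (1 + μ) := by
    refine hB.trans ?_
    rw [div_le_div_iff₀ (by nlinarith) (by positivity)]
    nlinarith
  have hsplit := Finset.sum_filter_add_sum_filter_not Finset.univ
    (fun π => fixedPointCount π < μ / 2) (convPow (topTwoShuffle (m + 2)) k)
  rw [sum_convPow sum_topTwoShuffle] at hsplit
  have hTV := (le_abs_self _).trans (abs_sum_sub_sum_le_tvDist
    (convPow (topTwoShuffle (m + 2)) k) (uniformDist (alternatingGroup (Fin (m + 2))))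
    (Finset.univ.filter fun π => ¬ fixedPointCount π < μ / 2))
  have h4 : 4 / (μ + 4) ≤ 4 / (1 + μ) :=
    div_le_div_of_nonneg_left (by norm_num) (by positivity) (by linarith)
  have h6 : 6 / (1 + μ) = 4 / (1 + μ) + 2 / (1 + μ) := by ring
  rw [h6]
  unfold shuffleTV
  linarith

end TopTwo

/-! ### Asymptotics of `μ` and the two conclusions. -/

open Filter Topology

/-- With `x = 1 / M`, `1 + x ≤ e^x` gives `1 - x ≥ e^{-x} (1 - x²)`. In the `k`-th power Bernoulli
leaves a loss of `k / M²`, at most `L / M` because `c < 0`. -/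
theorem exp_mul_le_one_sub_pow {M L c : ℝ} {k : ℕ} (hM : 1 ≤ M) (hc : c < 0)
    (hk : (k : ℝ) = M * (L + c)) :
    Real.exp (-L) * Real.exp (-c) * (1 - L / M) ≤ (1 - 1 / M) ^ k := by
  have hM0 : 0 < M := by linarith
  have hq : 0 ≤ 1 - 1 / M := by rw [sub_nonneg, div_le_one hM0]; exact hM
  have h1 : Real.exp (-L) * Real.exp (-c) = Real.exp (-(1 / M)) ^ k := by
    rw [← Real.exp_add, ← Real.exp_nat_mul, hk]
    congr 1
    field_simp
    ring
  have h2 : 1 - L / M ≤ (1 - (1 / M) ^ 2) ^ k := by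
    have hb := one_add_mul_le_pow (a := -(1 / M) ^ 2) (by
      have : (1 / M) ^ 2 ≤ 1 := pow_le_one₀ (by positivity) (by linarith)
      linarith) k
    rw [← sub_eq_add_neg] at hb
    refine le_trans ?_ hb
    have : (k : ℝ) * (1 / M) ^ 2 ≤ L / M := by
      rw [hk, show M * (L + c) * (1 / M) ^ 2 = (L + c) / M by field_simp]
      gcongr
      linarith
    linarith
  have h3 : Real.exp (-(1 / M)) * (1 - (1 / M) ^ 2) ≤ 1 - 1 / M := by
    have : Real.exp (-(1 / M)) * (1 + 1 / M) ≤ 1 := by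
      calc _ ≤ Real.exp (-(1 / M)) * Real.exp (1 / M) := by
            gcongr
            linarith [Real.add_one_le_exp (1 / M)]
        _ = 1 := by rw [← Real.exp_add]; simp
    nlinarith
  calc _ ≤ Real.exp (-(1 / M)) ^ k * (1 - (1 / M) ^ 2) ^ k := by
        rw [h1]; gcongr
    _ = (Real.exp (-(1 / M)) * (1 - (1 / M) ^ 2)) ^ k := (mul_pow _ _ _).symm
    _ ≤ _ := by
        refine pow_le_pow_left₀ (mul_nonneg (Real.exp_pos _).le ?_) h3 k
        have : (1 / M) ^ 2 ≤ 1 := pow_le_one₀ (by positivity) (by linarith)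
        linarith

/-- The correction `δ n` in the lower bound for the shuffle of `n` cards. -/
noncomputable def lowerBoundCorrection (n : ℕ) : ℝ :=
  (1 - 2 / (n : ℝ)) * (1 - Real.log n / ((n : ℝ) - 3 / 2)) - 1

theorem tendsto_lowerBoundCorrection : Tendsto lowerBoundCorrection atTop (𝓝 0) := by
  have h1 : Tendsto (fun n : ℕ => 2 / (n : ℝ)) atTop (𝓝 0) :=
    tendsto_const_div_atTop_nhds_zero_nat 2
  have h2 : Tendsto (fun n : ℕ => Real.log n / ((n : ℝ) - 3 / 2)) atTop (𝓝 0) := by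
    have := (Real.tendsto_pow_log_div_mul_add_atTop 1 (-(3 / 2)) 1 one_ne_zero).comp
      (tendsto_natCast_atTop_atTop (R := ℝ))
    refine this.congr fun n => ?_
    simp [sub_eq_add_neg]
  unfold lowerBoundCorrection
  simpa using
    (((tendsto_const_nhds (x := (1 : ℝ))).sub h1).mul
      ((tendsto_const_nhds (x := (1 : ℝ))).sub h2)).sub (tendsto_const_nhds (x := (1 : ℝ)))

theorem log_le_sub_three_halves {n : ℕ} (hn : 4 ≤ n) : Real.log n ≤ (n : ℝ) - 3 / 2 := by
  have hn' : (4 : ℝ) ≤ n := by exact_mod_cast hn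
  have h := Real.log_le_sub_one_of_pos (show (0 : ℝ) < n / 2 by positivity)
  rw [Real.log_div (by positivity) (by norm_num)] at h
  linarith [Real.log_two_lt_d9]

theorem one_sub_exp_le_shuffleTV {n : ℕ} (hn : 4 ≤ n) {c : ℝ} (hc : c < 0) {k : ℕ}
    (hk : (k : ℝ) = ((n : ℝ) - 3 / 2) * (Real.log n + c)) :
    1 - 6 / (1 + Real.exp (-c) * (1 + lowerBoundCorrection n)) ≤ shuffleTV n k := by
  have hlog := log_le_sub_three_halves hn
  obtain ⟨m, rfl⟩ : ∃ m, n = m + 2 := ⟨n - 2, by omega⟩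
  refine le_trans ?_ (one_sub_le_shuffleTV (m := m) (by omega) k)
  have hm : (2 : ℝ) ≤ m := by exact_mod_cast (by omega : 2 ≤ m)
  push_cast at hk hlog
  have hM : ((m : ℝ) + 2 - 3 / 2) = (2 * m + 1) / 2 := by ring
  rw [hM] at hk hlog
  have h := exp_mul_le_one_sub_pow (by linarith) hc hk
  rw [Real.exp_neg, Real.exp_log (by positivity), one_div_div] at h
  have hL : 0 ≤ 1 - Real.log ((m : ℝ) + 2) / ((2 * m + 1) / 2) := by
    rw [sub_nonneg, div_le_one (by positivity)]; exact hlog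
  -- The factor `1 - 2 / n` in the correction is `m / n`: only `m = n - 2` cards are counted, while
  -- `e^{-log n}` supplies `1 / n`.
  have hx : Real.exp (-c) * (1 + lowerBoundCorrection (m + 2)) =
      m * ((m + 2 : ℝ)⁻¹ * Real.exp (-c) *
        (1 - Real.log ((m : ℝ) + 2) / ((2 * m + 1) / 2))) := by
    simp only [lowerBoundCorrection]
    push_cast
    rw [hM]
    have : (1 : ℝ) - 2 / (m + 2) = m * (m + 2 : ℝ)⁻¹ := by field_simp; ring
    rw [this]
    ring
  rw [hx]
  gcongr

theorem tendsto_shuffleTV_floor {ε : ℝ} (hε : 0 < ε) (hε1 : ε < 1) :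
    Tendsto (fun n : ℕ => shuffleTV n ⌊(1 - ε) * ((n : ℝ) - 3 / 2) * Real.log n⌋₊)
      atTop (𝓝 1) := by
  have hd : ∀ᶠ n : ℕ in atTop, -(1 / 2) < lowerBoundCorrection n :=
    tendsto_lowerBoundCorrection.eventually_const_lt (by norm_num)
  have hlim : Tendsto (fun n : ℕ => 1 - 6 / (1 + (n : ℝ) ^ ε * (1 / 2))) atTop (𝓝 1) := by
    have h1 : Tendsto (fun n : ℕ => 1 + (n : ℝ) ^ ε * (1 / 2)) atTop atTop :=
      tendsto_atTop_add_const_left _ _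
        (((tendsto_rpow_atTop hε).comp tendsto_natCast_atTop_atTop).atTop_mul_const (by norm_num))
    simpa using (tendsto_const_nhds (x := (1 : ℝ))).sub (h1.const_div_atTop 6)
  refine tendsto_of_tendsto_of_tendsto_of_le_of_le' hlim tendsto_const_nhds ?_ ?_
  · filter_upwards [hd, eventually_ge_atTop 4] with n hn h4
    have h4' : (4 : ℝ) ≤ n := by exact_mod_cast h4
    have hM : 0 < (n : ℝ) - 3 / 2 := by linarith
    have hl : 0 < Real.log n := Real.log_pos (by linarith)
    set k := ⌊(1 - ε) * ((n : ℝ) - 3 / 2) * Real.log n⌋₊ with hk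
    have hkle : (k : ℝ) ≤ (1 - ε) * ((n : ℝ) - 3 / 2) * Real.log n :=
      Nat.floor_le (mul_nonneg (mul_nonneg (by linarith) hM.le) hl.le)
    have hc : (k : ℝ) / ((n : ℝ) - 3 / 2) - Real.log n ≤ -(ε * Real.log n) := by
      have : (k : ℝ) / ((n : ℝ) - 3 / 2) ≤ (1 - ε) * Real.log n := by
        rw [div_le_iff₀ hM]; linarith
      linarith
    -- The floor is absorbed by solving for `c`, which only makes it more negative.
    have h := one_sub_exp_le_shuffleTV h4
      (c := (k : ℝ) / ((n : ℝ) - 3 / 2) - Real.log n) (k := k)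
      (by have := mul_pos hε hl; linarith) (by rw [add_sub_cancel, mul_div_cancel₀ _ hM.ne'])
    refine le_trans ?_ h
    have he : (n : ℝ) ^ ε ≤ Real.exp (-((k : ℝ) / ((n : ℝ) - 3 / 2) - Real.log n)) := by
      rw [Real.rpow_def_of_pos (by linarith)]
      exact Real.exp_le_exp.2 (by linarith)
    gcongr
    linarith
  · filter_upwards [eventually_ge_atTop 2] with n hn
    obtain ⟨m, rfl⟩ : ∃ m, n = m + 2 := ⟨n - 2, by omega⟩
    exact shuffleTV_le_one m _

theorem mainTheorem3 :
    (∃ δ : ℕ → ℝ, Filter.Tendsto δ Filter.atTop (nhds 0) ∧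
      ∃ N : ℕ, ∀ n : ℕ, N ≤ n → ∀ c : ℝ, c < 0 → ∀ k : ℕ,
        (k : ℝ) = ((n : ℝ) - 3 / 2) * (Real.log n + c) →
          1 - 6 / (1 + Real.exp (-c) * (1 + δ n)) ≤ shuffleTV n k) ∧
    (∀ ε : ℝ, 0 < ε → ε < 1 →
      Filter.Tendsto
        (fun n : ℕ => shuffleTV n ⌊(1 - ε) * ((n : ℝ) - 3 / 2) * Real.log n⌋₊)
        Filter.atTop (nhds 1)) :=
  ⟨⟨lowerBoundCorrection, tendsto_lowerBoundCorrection, 4,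
    fun _ hn _ hc _ hk => one_sub_exp_le_shuffleTV hn hc hk⟩,
    fun _ hε hε1 => tendsto_shuffleTV_floor hε hε1⟩
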